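/- **Model.** A source stream $s[0],s[1],\dots$ is i.i.d. with a non-degenerate law $p$ on a finite set. A (causal) code produces channel symbols $x[t]=f_t(s[0],\dots,s[t])$. It serves a receiver with parameters $(B',T')$ if there are decoding functions $\gamma_t$ such that, whenever exactly the symbols $x[j],\dots,x[j+B'-1]$ are erased, for any $j\ge 0$, and $y$ denotes the resulting channel output (whose erased entries are marked as erasures), $\gamma_t(y[0],\dots,y[t+T'])=s[t]$ with probability one for every $t\ge 0$; the functions $\gamma_t$ do not depend on $j$. The rate of the code is $H(s)/H(x)$, the entropy of one source symbol divided by the marginal entropy of a channel symbol, where $H(x)=\limsup_{t\to\infty}H(x[t])$ if the marginal entropy depends on $t$. **Block code.** Let $1\le B\le T$, let $\mathbb F$ be a finite field and $H\in\mathbb F^{(T-B)\times B}$. Say that $[I\;H]$ is a burst-erasure block code if each codeword $(n,nH)$ of length $T$ is determined by its entries outside any window of $B$ cyclically consecutive positions. Put $r_k(b)=b_k+\sum_{m=B}^{T-1}b_mH_{m-B,k}$ for $b\in\mathbb F^T$ and $0\le k<B$. **DE-SCo.** Let $\alpha>1$ be an integer and $\ell=\alpha-1$. Write $s[t]=(s_0[t],\dots,s_{T-1}[t])\in\mathbb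 F^T$, uniformly distributed, with $s[t]=0$ for $t<0$. The DE-SCo of $H$ is the code $x[t]=(s[t],q[t])\in\mathbb F^T\times\mathbb F^B$ with $q_k[t]=p^{\rm I}_k[t]+p^{\rm II}_k[t-(T+B)]$, where $$p^{\rm I}_k[t]=r_k(b^{\rm I}_{t-T-k}),\qquad b^{\rm I}_i=(s_0[i],s_1[i+1],\dots,s_{T-1}[i+T-1]),$$ $$p^{\rm II}_k[t]=r_k(b^{\rm II}_{t-\ell(k+1)}),\qquad b^{\rm II}_i=(s_{T-1}[i-\ell(T-1)],s_{T-2}[i-\ell(T-2)],\dots,s_0[i]).$$ **Theorem 1.** Let $1\le B\le T$ and let $\alpha>1$ be an integer. Among the codes of rate $\frac{T}{T+B}$ that serve a first receiver with parameters $(B,T)$ and a second receiver with parameters $(\alpha B,T_2)$, the minimum possible value of the delay $T_2\in\mathbb N$ is $$T_2^\star=\alpha T+B .$$ More precisely: (1) every code that serves $(B,T)$ and $(\alpha B,T_2)$ with $T_2<\alpha T+B$ has rate strictly less than $\frac{T}{T+B}$; (2) over some finite field there is a matrix $H\in\mathbb F^{(T-B)\times B}$ such that $[I\;H]$ is a burst-erasure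 block code; and for every finite field $\mathbb F$ and every such $H$, the DE-SCo of $H$ has rate $\frac{T}{T+B}$ and serves both $(B,T)$ and $(\alpha B,\alpha T+B)$. -/

import Mathlib

open MeasureTheory Filter
open scoped ENNReal Matrix

namespace Streaming

universe u v

/-! ### Information measures for an i.i.d. source -/

/-- The law of an i.i.d. source stream `s[0], s[1], …` with marginal law `p`. -/
noncomputable def sourceLaw {S : Type u} [MeasurableSpace S] (p : Measure S) : Measure (ℕ → S) :=
  Measure.infinitePi (fun _ : ℕ => p)

/-- Shannon entropy (in nats) of a random variable `Y` taking finitely many values. -/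
noncomputable def shannonEntropy {Ω : Type u} [MeasurableSpace Ω] (μ : Measure Ω)
    {X : Type v} (Y : Ω → X) : ℝ :=
  ∑' x : X, Real.negMulLog (μ.real (Y ⁻¹' {x}))

/-- The entropy `H(s)` of one source symbol. -/
noncomputable def sourceEntropy {S : Type u} [MeasurableSpace S] (p : Measure S) : ℝ :=
  shannonEntropy p (id : S → S)

/-! ### Streaming codes over the burst-erasure channel -/

/-- A causal encoder: the channel symbol at time `t` is a function `f_t (s[0], …, s[t])`. -/
abbrev Encoder (S : Type u) (X : Type v) := (t : ℕ) → (Fin (t + 1) → S) → X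

/-- The channel symbol `x[t] = f_t (s[0], …, s[t])`. -/
def Encoder.output {S : Type u} {X : Type v} (f : Encoder S X) (s : ℕ → S) (t : ℕ) : X :=
  f t (fun i => s i)

/-- Output of the channel that erases `x[j], …, x[j + B - 1]`; an erasure is `none`. -/
def burstChannel {X : Type v} (j B : ℕ) (x : ℕ → X) (t : ℕ) : Option X :=
  if j ≤ t ∧ t < j + B then none else some (x t)

/-- The code `f` serves a receiver with burst length `B` and delay `T`: there are decoding
functions `γ_t`, not depending on the position `j` of the burst, such that
`γ_t (y[0], …, y[t + T])` equals `s[t]` with probability one, for every `j` and every `t`. -/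
def Achieves {S : Type u} [MeasurableSpace S] {X : Type v} (p : Measure S) (f : Encoder S X)
    (B T : ℕ) : Prop :=
  ∃ γ : (t : ℕ) → (Fin (t + T + 1) → Option X) → S,
    ∀ j t : ℕ, ∀ᵐ s ∂(sourceLaw p),
      γ t (fun i => burstChannel j B (f.output s) i) = s t

/-- The rate `H(s) / H(x)`.  The marginal entropy of `x[t]` may depend on `t` (for instance while
the memory of the encoder fills up), and `H(x)` is its upper limit as `t → ∞`. -/
noncomputable def rate {S : Type u} [MeasurableSpace S] {X : Type v} (p : Measure S)
    (f : Encoder S X) : ℝ≥0∞ :=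
  ENNReal.ofReal (sourceEntropy p) /
    limsup (fun t : ℕ => ENNReal.ofReal (shannonEntropy (sourceLaw p) (fun s => f.output s t)))
      atTop

/-- Some code of rate `R`, for some nondegenerate finite i.i.d. source, serves both the receiver
with parameters `(B₁, T₁)` and the receiver with parameters `(B₂, T₂)`. -/
def AchievableAtRate (R : ℝ≥0∞) (B₁ T₁ B₂ T₂ : ℕ) : Prop :=
  ∃ (S X : Type) (_ : Fintype S) (_ : MeasurableSpace S) (_ : DiscreteMeasurableSpace S)
    (p : Measure S) (_ : IsProbabilityMeasure p) (f : Encoder S X),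
    0 < sourceEntropy p ∧ rate p f = R ∧ Achieves p f B₁ T₁ ∧ Achieves p f B₂ T₂

/-! ### Burst-erasure block codes and the DE-SCo construction -/

section Construction

variable {F : Type u} [Field F] {B T : ℕ}

/-- The codeword `(n, n H)` of length `T` with systematic generator matrix `[I H]`. -/
def bebcWord (H : Matrix (Fin (T - B)) (Fin B) F) (n : Fin (T - B) → F) (m : ℕ) : F :=
  if h : m < T - B then n ⟨m, h⟩
  else if h' : m - (T - B) < B then (n ᵥ* H) ⟨m - (T - B), h'⟩ else 0

/-- `[I H]` generates a `(T, T - B)` burst-erasure block code: the information vector is determined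
by the codeword outside of any window of `B` cyclically consecutive positions
`a, a + 1, …, a + B - 1` modulo `T` (bursts inside the block and end-around bursts). -/
def IsBurstErasureBlockCode (H : Matrix (Fin (T - B)) (Fin B) F) : Prop :=
  ∀ a < T, ∀ n n' : Fin (T - B) → F,
    (∀ d, B ≤ d → d < T → bebcWord H n ((a + d) % T) = bebcWord H n' ((a + d) % T)) → n = n'

/-- Parity checks `r = u + n H` of the `(T + B, T)` low-delay burst-erasure block code, where the
information vector is `b = (u, n)` with `u = (b_0, …, b_{B-1})` and `n = (b_B, …, b_{T-1})`. -/
def ldParity (H : Matrix (Fin (T - B)) (Fin B) F) (b : ℕ → F) (k : Fin B) : F :=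
  b k + ∑ m : Fin (T - B), b (B + m) * H m k

/-- The sub-symbol `s_m[τ]` read off from `s[0], …, s[t]`; it is zero for `τ < 0`. -/
def subSymbol {t : ℕ} (s : Fin (t + 1) → Fin T → F) (m : ℕ) (τ : ℤ) : F :=
  if h : m < T ∧ 0 ≤ τ ∧ τ.toNat < t + 1 then s ⟨τ.toNat, h.2.2⟩ ⟨m, h.1⟩ else 0

/-- Main diagonal `b_i = (s_0[i], s_1[i + 1], …, s_{T-1}[i + T - 1])`. -/
def mainDiagonal (s : ℕ → ℤ → F) (i : ℤ) (m : ℕ) : F := s m (i + m)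

/-- Opposite diagonal with interleaving step `ℓ`:
`b_i = (s_{T-1}[i - ℓ (T - 1)], s_{T-2}[i - ℓ (T - 2)], …, s_0[i])`. -/
def offDiagonal (T ℓ : ℕ) (s : ℕ → ℤ → F) (i : ℤ) (m : ℕ) : F :=
  s (T - 1 - m) (i - ℓ * ((T - 1 - m : ℕ) : ℤ))

/-- Parity checks of the `(B, T)` SCo along the main diagonal: the `k`-th parity check of the
diagonal `b_i` is sent at time `i + T + k`. -/
def parityOne (H : Matrix (Fin (T - B)) (Fin B) F) (s : ℕ → ℤ → F) (k : Fin B) (t : ℤ) : F :=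
  ldParity H (mainDiagonal s (t - T - k)) k

/-- Parity checks of the `(ℓ B, ℓ T)` SCo along the opposite diagonal with interleaving step `ℓ`:
the `k`-th parity check of the diagonal `b_i` is placed at time `i + ℓ (k + 1)`. -/
def parityTwo (H : Matrix (Fin (T - B)) (Fin B) F) (ℓ : ℕ) (s : ℕ → ℤ → F) (k : Fin B) (t : ℤ) :
    F :=
  ldParity H (offDiagonal T ℓ s (t - ℓ * ((k : ℤ) + 1))) k

/-- The DE-SCo encoder: `x[t] = (s[t], q[t])` with `q[t] = pI[t] + pII[t - (T + B)]`, where the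
second family of parity checks uses the interleaving step `α - 1`. -/
def deSCo (H : Matrix (Fin (T - B)) (Fin B) F) (α : ℕ) :
    Encoder (Fin T → F) ((Fin T → F) × (Fin B → F)) :=
  fun t s =>
    (s (Fin.last t), fun k =>
      parityOne H (subSymbol s) k t + parityTwo H (α - 1) (subSymbol s) k ((t : ℤ) - (T + B)))

end Construction

/-- The uniform distribution on the source alphabet `F ^ T`. -/
noncomputable def uniformSource (F : Type u) [Fintype F] [Nonempty F] [MeasurableSpace F] (T : ℕ) :
    Measure (Fin T → F) :=
  (PMF.uniformOfFintype (Fin T → F)).toMeasure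

end Streaming

open Streaming

/-! Achievability. The DE-SCo is linear and time invariant, so a receiver works as soon as a stream
that is zero before time 0, and whose received symbols up to the deadline are zero, has `s[0] = 0`
(`deSCo_determined`). On one diagonal the low-delay code undoes a burst of length `B` by
`ld_info_eq_zero` and `ld_symbol_eq_zero`. Receiver 1 uses the main diagonals alone, since up to its
deadline the shifted checks pII only read symbols older than the burst.

For receiver 2 put `ℓ = α - 1` and let the burst be `[0, αB)`. From time `αB + T` on, the checks pI
only read received symbols, so pII becomes known on `[ℓB, ℓT]`. This leaves the low sub-symbols
`s_r`, `r < T - B`, which are recovered by induction over the opposite diagonals: on each one the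
entries of the last `B` erased times come from main diagonals, whose interference lies on earlier
opposite diagonals; the earlier entries then face a burst of only `ℓB` and follow from pII. Finally
`s[0]` itself is decoded along opposite diagonals; its last check arrives exactly at `αT + B`.

Converse. Erase the first `αB` symbols of each period `αB + αT - 1`. If `T₂ < αT + B`, decoder 2
recovers the first `(α - 1)B` source symbols of each erasure, after which decoder 1 sees a burst of
length `B` and recovers the rest (`output_eq_of_periodic`). So `αT - 1` channel symbols per period
carry the entropy of `αB + αT - 1` source symbols, and `(αT - 1)/(αB + αT - 1) < T/(T + B)`. The
entropy count rests on subadditivity, `entropy_le_sum_entropy`, applied to finite prefixes of the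
source.

Rate and existence. For `t ≥ T` the map from source prefix to channel symbol is a surjective
homomorphism, so `x[t]` is uniform on `F^(T+B)`. Systematic Reed-Solomon codes supply `H`. -/

namespace Streaming

/-! ### Decoding of the low-delay block code -/

section BlockCode

variable {F : Type*} [Field F] {B T : ℕ}

theorem bebcWord_zero (H : Matrix (Fin (T - B)) (Fin B) F) (m : ℕ) :
    bebcWord H (0 : Fin (T - B) → F) m = 0 := by
  unfold bebcWord
  split_ifs <;> simp

/-- A codeword of a burst-erasure block code vanishing on `T - B` cyclically consecutive positions
is zero. -/
theorem IsBurstErasureBlockCode.eq_zero {H : Matrix (Fin (T - B)) (Fin B) F}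
    (hH : IsBurstErasureBlockCode H) (hBT : B ≤ T) (hT : 0 < T) {n : Fin (T - B) → F} (a : ℕ)
    (hn : ∀ d < T - B, bebcWord H n ((a + d) % T) = 0) : n = 0 := by
  refine hH ((a + (T - B)) % T) (Nat.mod_lt _ hT) n 0 fun d hd hdT => ?_
  have h := hn (d - B) (by omega)
  have e : ((a + (T - B)) % T + d) % T = (a + (d - B)) % T := by
    rw [Nat.mod_add_mod, show a + (T - B) + d = a + (d - B) + T by omega, Nat.add_mod_right]
  rw [e, h, bebcWord_zero]

theorem ldParity_eq (H : Matrix (Fin (T - B)) (Fin B) F) (b : ℕ → F) (k : Fin B) :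
    ldParity H b k = b k + ((fun m : Fin (T - B) => b (B + m)) ᵥ* H) k := rfl

/-- If a burst hits the positions `a, …, a + B - 1`, then the last `T - B` information symbols
are determined by the parity checks of index `k < a`. -/
theorem ld_info_eq_zero {H : Matrix (Fin (T - B)) (Fin B) F} (hH : IsBurstErasureBlockCode H)
    (hBT : B ≤ T) {b : ℕ → F} {a : ℕ} (ha : a < T)
    (hb : ∀ i < T, i < a ∨ a + B ≤ i → b i = 0)
    (hr : ∀ k : Fin B, (k : ℕ) < a → a + B ≤ T + k → ldParity H b k = 0) :
    (fun m : Fin (T - B) => b (B + m)) = 0 := by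
  -- Position `m < T - B` of the codeword is `b (B + m)`, so the burst at `a, …, a + B - 1` leaves
  -- the cyclic window of length `T - B` starting at `a`. A parity position in that window has index
  -- `k < a`, where `b k = 0` and the check equals `(n H)_k`.
  refine hH.eq_zero hBT (by omega) a fun d hd => ?_
  have hmod : (a + d) % T = if a + d < T then a + d else a + d - T := by
    split_ifs with h
    · exact Nat.mod_eq_of_lt h
    · rw [Nat.mod_eq_sub_mod (by omega), Nat.mod_eq_of_lt (by omega)]
  unfold bebcWord
  split_ifs with h1 h2
  · refine hb _ (by omega) ?_
    simp only
    split_ifs at hmod <;> omega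
  · split_ifs at hmod with h3
    · have hp := hr ⟨(a + d) % T - (T - B), h2⟩ (by simp only; omega) (by simp only; omega)
      rw [ldParity_eq, hb _ (by simp only; omega) (Or.inl (by simp only; omega)), zero_add] at hp
      exact hp
    · omega
  · rfl

/-- If a burst hits the positions `a, …, a + B - 1`, then the information symbol of index `a`
is determined by the parity checks of index `k ≤ a`. -/
theorem ld_symbol_eq_zero {H : Matrix (Fin (T - B)) (Fin B) F} (hH : IsBurstErasureBlockCode H)
    (hBT : B ≤ T) {b : ℕ → F} {a : ℕ} (ha : a < T)
    (hb : ∀ i < T, i < a ∨ a + B ≤ i → b i = 0)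
    (hr : ∀ k : Fin B, (k : ℕ) ≤ a → a + B ≤ T + k → ldParity H b k = 0) : b a = 0 := by
  have hn := ld_info_eq_zero hH hBT ha hb fun k hk => hr k hk.le
  rcases lt_or_ge a B with h | h
  · have hp := hr ⟨a, h⟩ le_rfl (by simp only; omega)
    rw [ldParity_eq, hn] at hp
    simpa using hp
  · have := congrFun hn ⟨a - B, by omega⟩
    simpa [Nat.add_sub_cancel' h] using this

end BlockCode

/-! ### Parity checks of the two interleaved codes -/

section Parity

variable {F : Type*} [Field F] {B T : ℕ}

theorem parityOne_congr (H : Matrix (Fin (T - B)) (Fin B) F) {s s' : ℕ → ℤ → F} {k : Fin B} {t : ℤ}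
    (h0 : s k (t - T) = s' k (t - T))
    (h1 : ∀ r : ℕ, B ≤ r → r < T → s r (t - T - k + r) = s' r (t - T - k + r)) :
    parityOne H s k t = parityOne H s' k t := by
  simp only [parityOne, ldParity, mainDiagonal]
  congr 1
  · simpa using h0
  · exact Finset.sum_congr rfl fun m _ => by
      rw [h1 (B + m) (by omega) (by omega)]

/-- Of the first `B` entries of a diagonal, each check sees only its own, and with lag exactly `ℓ
T`. All other sub-symbols it reads have index below `T - B`, which is why receiver 2 can start with
these. -/
theorem parityTwo_congr (H : Matrix (Fin (T - B)) (Fin B) F) (hBT : B ≤ T) {ℓ : ℕ}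
    {s s' : ℕ → ℤ → F} {k : Fin B} {t : ℤ}
    (h0 : s (T - 1 - k) (t - ℓ * T) = s' (T - 1 - k) (t - ℓ * T))
    (h1 : ∀ r : ℕ, r < T - B →
      s r (t - ℓ * (k + 1) - ℓ * r) = s' r (t - ℓ * (k + 1) - ℓ * r)) :
    parityTwo H ℓ s k t = parityTwo H ℓ s' k t := by
  simp only [parityTwo, ldParity, offDiagonal]
  congr 1
  · have e : t - ℓ * ((k : ℤ) + 1) - ℓ * ((T - 1 - k : ℕ) : ℤ) = t - ℓ * T := by
      have hk := k.2
      have : ((T - 1 - k : ℕ) : ℤ) = T - 1 - k := by omega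
      rw [this]; ring
    rw [e, h0]
  · exact Finset.sum_congr rfl fun m _ => by
      rw [h1 (T - 1 - (B + m)) (by omega)]

theorem parityOne_zero (H : Matrix (Fin (T - B)) (Fin B) F) (k : Fin B) (t : ℤ) :
    parityOne H (0 : ℕ → ℤ → F) k t = 0 := by
  simp [parityOne, ldParity, mainDiagonal]

theorem parityTwo_zero (H : Matrix (Fin (T - B)) (Fin B) F) (ℓ : ℕ) (k : Fin B) (t : ℤ) :
    parityTwo H ℓ (0 : ℕ → ℤ → F) k t = 0 := by
  simp [parityTwo, ldParity, offDiagonal]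

theorem parityOne_eq_zero (H : Matrix (Fin (T - B)) (Fin B) F) {s : ℕ → ℤ → F} {k : Fin B} {t : ℤ}
    (h0 : s k (t - T) = 0) (h1 : ∀ r : ℕ, B ≤ r → r < T → s r (t - T - k + r) = 0) :
    parityOne H s k t = 0 :=
  (parityOne_congr H (s' := 0) h0 h1).trans (parityOne_zero H k t)

theorem parityTwo_eq_zero (H : Matrix (Fin (T - B)) (Fin B) F) (hBT : B ≤ T) {ℓ : ℕ}
    {s : ℕ → ℤ → F} {k : Fin B} {t : ℤ} (h0 : s (T - 1 - k) (t - ℓ * T) = 0)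
    (h1 : ∀ r : ℕ, r < T - B → s r (t - ℓ * (k + 1) - ℓ * r) = 0) :
    parityTwo H ℓ s k t = 0 :=
  (parityTwo_congr H hBT (s' := 0) h0 h1).trans (parityTwo_zero H ℓ k t)

theorem ldParity_sub (H : Matrix (Fin (T - B)) (Fin B) F) (b b' : ℕ → F) (k : Fin B) :
    ldParity H (b - b') k = ldParity H b k - ldParity H b' k := by
  simp only [ldParity, Pi.sub_apply, sub_mul, Finset.sum_sub_distrib]
  ring

theorem parityOne_shift_sub (H : Matrix (Fin (T - B)) (Fin B) F) (s s' : ℕ → ℤ → F) (k : Fin B)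
    (j t : ℤ) :
    parityOne H (fun m τ => s m (τ + j) - s' m (τ + j)) k t =
      parityOne H s k (t + j) - parityOne H s' k (t + j) := by
  simp only [parityOne]
  rw [← ldParity_sub]
  congr 1
  funext m
  simp only [mainDiagonal, Pi.sub_apply]
  congr 2 <;> ring

theorem parityTwo_shift_sub (H : Matrix (Fin (T - B)) (Fin B) F) (ℓ : ℕ) (s s' : ℕ → ℤ → F)
    (k : Fin B) (j t : ℤ) :
    parityTwo H ℓ (fun m τ => s m (τ + j) - s' m (τ + j)) k t =
      parityTwo H ℓ s k (t + j) - parityTwo H ℓ s' k (t + j) := by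
  simp only [parityTwo]
  rw [← ldParity_sub]
  congr 1
  funext m
  simp only [offDiagonal, Pi.sub_apply]
  congr 2 <;> ring

/-! ### Decoding a burst starting at time zero -/

/-- Receiver 1 recovers the first symbol of a burst of length `B` with delay `T`. -/
theorem first_receiver_eq_zero {H : Matrix (Fin (T - B)) (Fin B) F}
    (hH : IsBurstErasureBlockCode H) (hBT : B ≤ T) {ℓ : ℕ} {s : ℕ → ℤ → F}
    (hs : ∀ m < T, ∀ τ : ℤ, τ < 0 ∨ (B : ℤ) ≤ τ ∧ τ ≤ T → s m τ = 0)
    (hq : ∀ (k : Fin B) (τ : ℤ), (B : ℤ) ≤ τ → τ ≤ T →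
      parityOne H s k τ + parityTwo H ℓ s k (τ - (T + B)) = 0) :
    ∀ m < T, s m 0 = 0 := by
  intro m hm
  have key := ld_symbol_eq_zero hH hBT (b := mainDiagonal s (-m)) hm
    (fun i hi h => hs i hi _ (by omega)) (fun k hk hk' => ?_)
  · simpa [mainDiagonal] using key
  have hkB := k.2
  have h := hq k (T + k - m) (by omega) (by omega)
  rw [parityTwo_eq_zero H hBT, add_zero] at h
  · rw [parityOne] at h
    convert h using 3
    ring
  · have : (0 : ℤ) ≤ ℓ * T := by positivity
    exact hs _ (by omega) _ (Or.inl (by omega))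
  · intro r hr
    have h1 : (0 : ℤ) ≤ ℓ * (k + 1) := by positivity
    have h2 : (0 : ℤ) ≤ ℓ * r := by positivity
    exact hs _ (by omega) _ (Or.inl (by omega))

section SecondReceiver

variable {H : Matrix (Fin (T - B)) (Fin B) F} {ℓ : ℕ} {s : ℕ → ℤ → F}

/-- The parity checks along the opposite diagonals which receiver 2 obtains after the interference
of the main diagonals has vanished. -/
theorem parityTwo_eq_zero_of_received (hBT : B ≤ T)
    (hs : ∀ m < T, ∀ τ : ℤ, τ < 0 ∨ (((ℓ + 1) * B : ℕ) : ℤ) ≤ τ ∧ τ ≤ ((ℓ + 1) * T + B : ℕ) →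
      s m τ = 0)
    (hq : ∀ (k : Fin B) (τ : ℤ), (((ℓ + 1) * B : ℕ) : ℤ) ≤ τ → τ ≤ ((ℓ + 1) * T + B : ℕ) →
      parityOne H s k τ + parityTwo H ℓ s k (τ - (T + B)) = 0)
    (k : Fin B) (τ : ℤ) (h1 : (ℓ : ℤ) * B ≤ τ) (h2 : τ ≤ ℓ * T) : parityTwo H ℓ s k τ = 0 := by
  have hkB := k.2
  push_cast at hs hq
  have h := hq k (τ + (T + B)) (by linarith) (by linarith)
  rw [parityOne_eq_zero H, zero_add, add_sub_cancel_right] at h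
  · exact h
  · exact hs _ (by omega) _ (Or.inr ⟨by linarith, by linarith⟩)
  · intro r hr hr'
    have hr1 : (B : ℤ) ≤ r := by exact_mod_cast hr
    have hr2 : (r : ℤ) < T := by exact_mod_cast hr'
    have hk2 : (k : ℤ) < B := by exact_mod_cast hkB
    exact hs _ hr' _ (Or.inr ⟨by linarith, by linarith⟩)

/-- Receiver 2 recovers all the sub-symbols `s_r[t]` with `r < T - B`, in the order of the
opposite diagonals containing them. -/
theorem low_subSymbols_eq_zero (hH : IsBurstErasureBlockCode H) (hBT : B ≤ T) (hℓ : 1 ≤ ℓ)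
    (hs : ∀ m < T, ∀ τ : ℤ, τ < 0 ∨ (((ℓ + 1) * B : ℕ) : ℤ) ≤ τ ∧ τ ≤ ((ℓ + 1) * T + B : ℕ) →
      s m τ = 0)
    (hq : ∀ (k : Fin B) (τ : ℤ), (((ℓ + 1) * B : ℕ) : ℤ) ≤ τ → τ ≤ ((ℓ + 1) * T + B : ℕ) →
      parityOne H s k τ + parityTwo H ℓ s k (τ - (T + B)) = 0) (D : ℕ) :
    ∀ r < T - B, ∀ t : ℤ, t < (((ℓ + 1) * B : ℕ) : ℤ) → t + ℓ * r = D → s r t = 0 := by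
  have hp2 := parityTwo_eq_zero_of_received hBT hs hq
  induction D using Nat.strong_induction_on with
  | _ D ih =>
  have hℓ' : (1 : ℤ) ≤ ℓ := by exact_mod_cast hℓ
  have hBT' : (B : ℤ) ≤ T := by exact_mod_cast hBT
  have hℓBT : (ℓ : ℤ) * B ≤ ℓ * T := by gcongr
  -- everything on an earlier opposite diagonal vanishes
  have ih' : ∀ r < T - B, ∀ t : ℤ, t < (((ℓ + 1) * B : ℕ) : ℤ) → t + ℓ * r < D → s r t = 0 := by
    intro r hr t ht htD
    rcases lt_or_ge t 0 with h | h
    · exact hs r (by omega) t (Or.inl h)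
    · have : (0 : ℤ) ≤ ℓ * r := by positivity
      exact ih (t + ℓ * r).toNat (by omega) r hr t ht (by omega)
  push_cast at hs hq ih' ⊢
  -- the last `B` erased symbols are recovered along the main diagonals
  have late : ∀ r < T - B, ∀ t : ℤ, (ℓ : ℤ) * B ≤ t → t < (ℓ + 1) * B → t + ℓ * r = D →
      s r t = 0 := by
    intro r hr t ht1 ht2 htD
    -- On the main diagonal through `s_r[t]`, entries before position `r` lie on earlier opposite
    -- diagonals, and entries from `r + B` on fall after the burst because `t ≥ ℓ B`.
    have key := ld_symbol_eq_zero hH hBT (b := mainDiagonal s (t - r)) (a := r) (by omega)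
      (fun i hi h => ?_) (fun k hk hk' => ?_)
    · simpa [mainDiagonal] using key
    · simp only [mainDiagonal]
      rcases h with h | h
      · have h' : (i : ℤ) + 1 ≤ r := by exact_mod_cast h
        refine ih' i (by omega) _ (by linarith) ?_
        have : (ℓ : ℤ) * i ≤ ℓ * r := by gcongr
        linarith
      · have h' : (r : ℤ) + B ≤ i := by exact_mod_cast h
        have hi' : (i : ℤ) < T := by exact_mod_cast hi
        exact hs i hi _ (Or.inr ⟨by linarith, by linarith⟩)
    · have hkB : (k : ℤ) < B := by exact_mod_cast k.2
      have hk1 : (k : ℤ) ≤ r := by exact_mod_cast hk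
      have hk2 : (r : ℤ) + B ≤ T + k := by exact_mod_cast hk'
      have h := hq k (t - r + T + k) (by linarith) (by linarith)
      -- The interfering check reads one sub-symbol at negative time; its others lie on the opposite
      -- diagonal of index `t - r + k - B - ℓ (k + 1) < D`.
      rw [parityTwo_eq_zero H hBT, add_zero] at h
      · rw [parityOne] at h
        convert h using 3
        ring
      · exact hs _ (by omega) _ (Or.inl (by linarith))
      · intro r' hr'
        have e1 : (k : ℤ) ≤ ℓ * k := le_mul_of_one_le_left (by positivity) hℓ'
        have e2 : (0 : ℤ) ≤ ℓ * r' := by positivity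
        have e3 : (0 : ℤ) ≤ ℓ * r := by positivity
        exact ih' r' hr' _ (by linarith) (by linarith)
  intro r hr t ht htD
  rcases le_or_gt ((ℓ : ℤ) * B) t with hlate | hearly
  · exact late r hr t hlate ht htD
  -- the other ones are recovered along the opposite diagonal
  rcases lt_or_ge t 0 with hneg | hnn
  · exact hs r (by omega) t (Or.inl hneg)
  classical
  -- The least such `a` is the first position of the diagonal at nonnegative time. From `a + B` on,
  -- times are at least `ℓ B`, so those entries are already recovered or received.
  have hex : ∃ a : ℕ, a < T ∧ (0 : ℤ) ≤ D - ℓ * ((T - 1 - a : ℕ) : ℤ) :=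
    ⟨T - 1 - r, by omega, by rw [show T - 1 - (T - 1 - r) = r by omega]; linarith⟩
  obtain ⟨haT, ha0⟩ := Nat.find_spec hex
  have hmin := fun i => Nat.find_min hex (m := i)
  set a := Nat.find hex with ha
  have hcast : ∀ i < T, ((T - 1 - i : ℕ) : ℤ) = T - 1 - i := by intro i hi; omega
  -- Minimality of `a` keeps the checks in time: `D < ℓ (T - a)` and `k < a` give `D + ℓ (k + 1) ≤ ℓ
  -- T`. No check is needed when `a = 0`.
  have hafirst : a = 0 ∨ (D : ℤ) - ℓ * ((T - 1 - a : ℕ) : ℤ) < ℓ := by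
    rcases Nat.eq_zero_or_pos a with h | h
    · exact Or.inl h
    · right
      by_contra! hc
      refine hmin (a - 1) (by omega) ⟨by omega, ?_⟩
      rw [show T - 1 - (a - 1) = T - 1 - a + 1 by omega]
      push_cast
      linarith
  have hn := ld_info_eq_zero hH hBT (b := offDiagonal T ℓ s D) haT (fun i hi h => ?_)
    (fun k hk hk' => ?_)
  · have := congrFun hn ⟨T - 1 - r - B, by omega⟩
    simp only [offDiagonal, Pi.zero_apply] at this
    rw [show T - 1 - (B + (T - 1 - r - B)) = r by omega,
      show (D : ℤ) - ℓ * r = t by linarith] at this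
    exact this
  · simp only [offDiagonal]
    rcases h with h | h
    · refine hs _ (by omega) _ (Or.inl ?_)
      by_contra! hc
      exact hmin i h ⟨hi, hc⟩
    · rw [hcast a haT] at ha0
      have hi' := hcast i hi
      have h' : (a : ℤ) + B ≤ i := by exact_mod_cast h
      have hge : (ℓ : ℤ) * B ≤ D - ℓ * ((T - 1 - i : ℕ) : ℤ) := by
        rw [hi']
        have : (ℓ : ℤ) * (a + B) ≤ ℓ * i := by gcongr
        linarith
      rcases lt_or_ge ((D : ℤ) - ℓ * ((T - 1 - i : ℕ) : ℤ)) ((ℓ + 1) * B) with hlt | hge'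
      · exact late _ (by omega) _ hge hlt (by ring)
      · refine hs _ (by omega) _ (Or.inr ⟨hge', ?_⟩)
        have hr' : (r : ℤ) + 1 + B ≤ T := by omega
        have e1 : (ℓ : ℤ) * (r + 1 + B) ≤ ℓ * T := by gcongr
        have e2 : (0 : ℤ) ≤ ℓ * ((T - 1 - i : ℕ) : ℤ) := by positivity
        linarith
  · have h := hp2 k (D + ℓ * (k + 1)) ?_ ?_
    · rw [parityTwo] at h
      convert h using 3
      ring
    · rw [hcast a haT] at ha0
      have hk2 : (a : ℤ) + B ≤ T + k := by exact_mod_cast hk'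
      have : (ℓ : ℤ) * (a + B) ≤ ℓ * (T + k) := by gcongr
      linarith
    · have hlt := hafirst.resolve_left (by omega)
      rw [hcast a haT] at hlt
      have hk2 : (k : ℤ) + 1 ≤ a := by exact_mod_cast hk
      have : (ℓ : ℤ) * (k + 1) ≤ ℓ * a := by gcongr
      linarith

/-- Receiver 2 recovers the first symbol of a burst of length `α B` with delay `α T + B`. -/
theorem second_receiver_eq_zero (hH : IsBurstErasureBlockCode H) (hBT : B ≤ T) (hℓ : 1 ≤ ℓ)
    (hs : ∀ m < T, ∀ τ : ℤ, τ < 0 ∨ (((ℓ + 1) * B : ℕ) : ℤ) ≤ τ ∧ τ ≤ ((ℓ + 1) * T + B : ℕ) →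
      s m τ = 0)
    (hq : ∀ (k : Fin B) (τ : ℤ), (((ℓ + 1) * B : ℕ) : ℤ) ≤ τ → τ ≤ ((ℓ + 1) * T + B : ℕ) →
      parityOne H s k τ + parityTwo H ℓ s k (τ - (T + B)) = 0) :
    ∀ m < T, s m 0 = 0 := by
  intro r hr
  have hlow := low_subSymbols_eq_zero hH hBT hℓ hs hq
  have hp2 := parityTwo_eq_zero_of_received hBT hs hq
  have hr' : ((T - 1 - r : ℕ) : ℤ) = T - 1 - r := by omega
  have hBT' : (B : ℤ) ≤ T := by exact_mod_cast hBT
  push_cast at hs hlow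
  have key := ld_symbol_eq_zero hH hBT (b := offDiagonal T ℓ s (ℓ * r)) (a := T - 1 - r) (by omega)
    (fun i hi h => ?_) (fun k hk hk' => ?_)
  · simpa [offDiagonal, show T - 1 - (T - 1 - r) = r by omega] using key
  · simp only [offDiagonal]
    have hi' : ((T - 1 - i : ℕ) : ℤ) = T - 1 - i := by omega
    rcases h with h | h
    · refine hs _ (by omega) _ (Or.inl ?_)
      have h1 : (r : ℤ) + 1 ≤ ((T - 1 - i : ℕ) : ℤ) := by omega
      have : (ℓ : ℤ) * (r + 1) ≤ ℓ * ((T - 1 - i : ℕ) : ℤ) := by gcongr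
      have : (1 : ℤ) ≤ ℓ := by exact_mod_cast hℓ
      linarith
    · rcases lt_or_ge ((ℓ : ℤ) * r - ℓ * ((T - 1 - i : ℕ) : ℤ)) ((ℓ + 1) * B) with hlt | hge
      · exact hlow (ℓ * r) _ (by omega) _ hlt (by push_cast; ring)
      · refine hs _ (by omega) _ (Or.inr ⟨hge, ?_⟩)
        have h1 : (r : ℤ) ≤ T := by omega
        have e1 : (ℓ : ℤ) * r ≤ ℓ * T := by gcongr
        have e2 : (0 : ℤ) ≤ ℓ * ((T - 1 - i : ℕ) : ℤ) := by positivity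
        linarith
  -- With `k ≤ T - 1 - r` the check times are at most `ℓ T`, and equality is possible: this is where
  -- the delay `α T + B` is used up.
  · have h := hp2 k (ℓ * r + ℓ * (k + 1)) ?_ ?_
    · rw [parityTwo] at h
      convert h using 3
      ring
    · have h1 : (B : ℤ) ≤ r + (k + 1) := by omega
      have : (ℓ : ℤ) * B ≤ ℓ * (r + (k + 1)) := by gcongr
      linarith
    · have h1 : (r : ℤ) + (k + 1) ≤ T := by omega
      have : (ℓ : ℤ) * (r + (k + 1)) ≤ ℓ * T := by gcongr
      linarith

end SecondReceiver

end Parity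

/-! ### From decodability to decoding functions -/

/-- If the unerased channel symbols determine `s[t]`, then decoding functions exist. -/
theorem achieves_of_determined {S X : Type*} [MeasurableSpace S] [Nonempty S] (p : Measure S)
    (f : Encoder S X) {B D : ℕ}
    (h : ∀ (j t : ℕ) (s s' : ℕ → S),
      (∀ i ≤ t + D, ¬ (j ≤ i ∧ i < j + B) → f.output s i = f.output s' i) → s t = s' t) :
    Achieves p f B D := by
  classical
  refine ⟨fun t y => Classical.epsilon fun a => ∃ (j : ℕ) (s : ℕ → S),
    (fun i : Fin (t + D + 1) => burstChannel j B (f.output s) i) = y ∧ s t = a, fun j t =>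
    Eventually.of_forall fun s => ?_⟩
  obtain ⟨j', s', hy, hs'⟩ := Classical.epsilon_spec (p := fun a => ∃ (j' : ℕ) (s' : ℕ → S),
    (fun i : Fin (t + D + 1) => burstChannel j' B (f.output s') i) =
      (fun i : Fin (t + D + 1) => burstChannel j B (f.output s) i) ∧ s' t = a) ⟨s t, j, s, rfl, rfl⟩
  refine hs'.symm.trans (h j t s s' fun i hi hij => ?_).symm
  have := congrFun hy ⟨i, by omega⟩
  -- The guessed burst `j'` may differ from `j`, but erasures are marked, so a position received
  -- under `j` is also received under `j'`.
  simp only [burstChannel, if_neg hij] at this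
  split_ifs at this
  exact (Option.some.inj this).symm

section DeSCo

variable {F : Type*} [Field F] {B T : ℕ}

/-- The sub-symbol `s_m[τ]` of a whole stream, extended by zero. -/
def streamSymbol (s : ℕ → Fin T → F) (m : ℕ) (τ : ℤ) : F :=
  if h : m < T ∧ 0 ≤ τ then s τ.toNat ⟨m, h.1⟩ else 0

theorem subSymbol_eq_streamSymbol (s : ℕ → Fin T → F) {t : ℕ} (m : ℕ) {τ : ℤ} (h : τ ≤ t) :
    subSymbol (fun i : Fin (t + 1) => s i) m τ = streamSymbol s m τ := by
  unfold subSymbol streamSymbol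
  by_cases h1 : m < T ∧ 0 ≤ τ
  · rw [dif_pos ⟨h1.1, h1.2, by omega⟩, dif_pos h1]
  · rw [dif_neg (fun hc => h1 ⟨hc.1, hc.2.1⟩), dif_neg h1]

theorem streamSymbol_coe (s : ℕ → Fin T → F) (m : Fin T) (t : ℕ) :
    streamSymbol s m t = s t m := by
  simp [streamSymbol]

/-- Causality of the checks: they never read past time `t`, so the truncation in `subSymbol` loses
nothing. -/
theorem deSCo_output (H : Matrix (Fin (T - B)) (Fin B) F) (hBT : B ≤ T) (α : ℕ)
    (s : ℕ → Fin T → F) (t : ℕ) :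
    (deSCo H α).output s t = (s t, fun k => parityOne H (streamSymbol s) k t +
      parityTwo H (α - 1) (streamSymbol s) k ((t : ℤ) - (T + B))) := by
  simp only [Encoder.output, deSCo, Fin.val_last]
  congr 1
  funext k
  have hk := k.2
  congr 1
  · exact parityOne_congr H (subSymbol_eq_streamSymbol s _ (by omega))
      fun r _ _ => subSymbol_eq_streamSymbol s _ (by omega)
  · refine parityTwo_congr H hBT (subSymbol_eq_streamSymbol s _ ?_)
      fun r _ => subSymbol_eq_streamSymbol s _ ?_
    · have : (0 : ℤ) ≤ ((α - 1 : ℕ) : ℤ) * T := by positivity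
      omega
    · have h1 : (0 : ℤ) ≤ ((α - 1 : ℕ) : ℤ) * (k + 1) := by positivity
      have h2 : (0 : ℤ) ≤ ((α - 1 : ℕ) : ℤ) * r := by positivity
      omega

/-- By linearity and time invariance, it suffices to decode the first symbol of a burst starting at
time zero. -/
theorem deSCo_determined {H : Matrix (Fin (T - B)) (Fin B) F} (hBT : B ≤ T) {α B' D : ℕ}
    (hzero : ∀ s : ℕ → ℤ → F,
      (∀ m < T, ∀ τ : ℤ, τ < 0 ∨ (B' : ℤ) ≤ τ ∧ τ ≤ D → s m τ = 0) →
      (∀ (k : Fin B) (τ : ℤ), (B' : ℤ) ≤ τ → τ ≤ D →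
        parityOne H s k τ + parityTwo H (α - 1) s k (τ - (T + B)) = 0) →
      ∀ m < T, s m 0 = 0)
    (j t : ℕ) (s s' : ℕ → Fin T → F)
    (h : ∀ i ≤ t + D, ¬ (j ≤ i ∧ i < j + B') →
      (deSCo H α).output s i = (deSCo H α).output s' i) : s t = s' t := by
  induction t using Nat.strong_induction_on with
  | _ t ih =>
  simp only [deSCo_output H hBT] at h ih
  by_cases ht : j ≤ t ∧ t < j + B'
  swap
  · exact congrArg Prod.fst (h t (by omega) ht)
  have hpast : ∀ i < t, s i = s' i := fun i hi => ih i hi fun i' hi' => h i' (by omega)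
  have hsym : ∀ (m : ℕ) (i : ℕ), s i = s' i → streamSymbol s m i = streamSymbol s' m i := by
    intro m i hi
    simp only [streamSymbol, Int.toNat_natCast, hi]
  -- With the past already recovered, the difference stream moved to origin `t` sees at most the
  -- burst `[0, B')`.
  have hz := hzero (fun m τ => streamSymbol s m (τ + t) - streamSymbol s' m (τ + t)) ?_ ?_
  · funext m
    have := hz m m.2
    rw [zero_add, streamSymbol_coe, streamSymbol_coe] at this
    exact sub_eq_zero.1 this
  · intro m hm τ hτ
    rw [sub_eq_zero]
    rcases lt_or_ge (τ + t) 0 with hneg | hnn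
    · simp only [streamSymbol]
      rw [dif_neg (by omega), dif_neg (by omega)]
    · lift τ + t to ℕ using hnn with i hi
      refine hsym m i ?_
      rcases hτ with hτ | hτ
      · exact hpast i (by omega)
      · exact congrArg Prod.fst (h i (by omega) (by omega))
  · intro k τ h1 h2
    rw [parityOne_shift_sub, parityTwo_shift_sub]
    obtain ⟨i, hi⟩ := Int.eq_ofNat_of_zero_le (show 0 ≤ τ + t by omega)
    have := congrFun (congrArg Prod.snd (h i (by omega) (by omega))) k
    simp only at this
    rw [show τ - (T + B) + t = (τ + t) - (T + B) by ring, hi]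
    linear_combination this

theorem deSCo_achieves_first [MeasurableSpace F] (p : Measure (Fin T → F))
    {H : Matrix (Fin (T - B)) (Fin B) F} (hH : IsBurstErasureBlockCode H) (hBT : B ≤ T) (α : ℕ) :
    Achieves p (deSCo H α) B T :=
  achieves_of_determined p _ (deSCo_determined hBT fun _ => first_receiver_eq_zero hH hBT)

theorem deSCo_achieves_second [MeasurableSpace F] (p : Measure (Fin T → F))
    {H : Matrix (Fin (T - B)) (Fin B) F} (hH : IsBurstErasureBlockCode H) (hBT : B ≤ T) {α : ℕ}
    (hα : 1 < α) : Achieves p (deSCo H α) (α * B) (α * T + B) := by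
  obtain ⟨ℓ, rfl⟩ : ∃ ℓ, α = ℓ + 1 := ⟨α - 1, by omega⟩
  exact achieves_of_determined p _ (deSCo_determined hBT fun _ =>
    second_receiver_eq_zero hH hBT (by omega))

end DeSCo

end Streaming
namespace Streaming

/-! ### Entropy on a finite weighted space -/

section FiniteEntropy

variable {Ω : Type*} [Fintype Ω] {X : Type*}

open scoped Classical in
/-- The distribution of `Y` under the weights `w`. -/
noncomputable def weightedLaw (w : Ω → ℝ) (Y : Ω → X) (x : X) : ℝ :=
  ∑ ω with Y ω = x, w ω

theorem weightedLaw_nonneg {w : Ω → ℝ} (hw : ∀ ω, 0 ≤ w ω) (Y : Ω → X) (x : X) :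
    0 ≤ weightedLaw w Y x :=
  Finset.sum_nonneg fun ω _ => hw ω

theorem le_weightedLaw {w : Ω → ℝ} (hw : ∀ ω, 0 ≤ w ω) (Y : Ω → X) (ω : Ω) :
    w ω ≤ weightedLaw w Y (Y ω) := by
  classical
  exact Finset.single_le_sum (f := w) (fun ω _ => hw ω) (by simp)

/-- Entropy as the mean of `-log` of the probability of the observed value. It allows an infinite
`X`, since values outside the range of `Y` contribute `negMulLog 0 = 0`. -/
theorem tsum_negMulLog_weightedLaw (w : Ω → ℝ) (Y : Ω → X) :
    ∑' x, Real.negMulLog (weightedLaw w Y x) =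
      ∑ ω, w ω * -Real.log (weightedLaw w Y (Y ω)) := by
  classical
  rw [tsum_eq_sum (s := Finset.univ.image Y)]
  · rw [← Finset.sum_fiberwise_of_maps_to (s := Finset.univ) (t := Finset.univ.image Y) (g := Y)
      (fun ω _ => Finset.mem_image_of_mem _ (Finset.mem_univ ω))]
    refine Finset.sum_congr rfl fun x _ => ?_
    rw [Finset.sum_congr rfl (g := fun ω => w ω * -Real.log (weightedLaw w Y x))
      (fun ω hω => by rw [(Finset.mem_filter.1 hω).2]), ← Finset.sum_mul, Real.negMulLog]
    simp only [weightedLaw]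
    ring
  · intro x hx
    have : weightedLaw w Y x = 0 :=
      Finset.sum_eq_zero fun ω hω => absurd (Finset.mem_image.2
        ⟨ω, Finset.mem_univ _, (Finset.mem_filter.1 hω).2⟩) hx
    simp [this]

theorem sum_image_weightedLaw [DecidableEq X] (w : Ω → ℝ) (Y : Ω → X) :
    ∑ x ∈ Finset.univ.image Y, weightedLaw w Y x = ∑ ω, w ω := by
  rw [← Finset.sum_fiberwise_of_maps_to (s := Finset.univ) (t := Finset.univ.image Y) (g := Y)
    (fun ω _ => Finset.mem_image_of_mem _ (Finset.mem_univ ω))]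
  refine Finset.sum_congr rfl fun x _ => ?_
  unfold weightedLaw
  congr!

/-- If `V` is almost surely a function of the family `Y`, then `H(V) ≤ ∑ H(Y_i)`. -/
theorem entropy_le_sum_entropy {A ι : Type*} [Fintype ι] {w : Ω → ℝ} (hw : ∀ ω, 0 ≤ w ω)
    (hw1 : ∑ ω, w ω = 1) (V : Ω → A) (Y : ι → Ω → X)
    (hV : ∀ ω ω', 0 < w ω → 0 < w ω' → (∀ i, Y i ω = Y i ω') → V ω = V ω') :
    ∑ ω, w ω * -Real.log (weightedLaw w V (V ω)) ≤
      ∑ i, ∑ ω, w ω * -Real.log (weightedLaw w (Y i) (Y i ω)) := by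
  classical
  set P : ι → X → ℝ := fun i => weightedLaw w (Y i) with hP
  set Q : A → ℝ := weightedLaw w V with hQ
  have hP0 : ∀ i x, 0 ≤ P i x := fun i x => weightedLaw_nonneg hw _ _
  have hQ0 : ∀ x, 0 ≤ Q x := fun x => weightedLaw_nonneg hw _ _
  -- the expected likelihood ratio is at most one
  have hR : ∑ ω, w ω * ((∏ i, P i (Y i ω)) / Q (V ω)) ≤ 1 := by
    set Z : Ω → ι → X := fun ω i => Y i ω with hZ
    -- On a fibre of `Z` the value of `V` is constant up to weight zero, so the fibre weighs at most
    -- `Q (V ω₀)` and the denominator cancels.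
    have hfib : ∀ z, ∑ ω with Z ω = z, w ω * ((∏ i, P i (Y i ω)) / Q (V ω)) ≤
        ∏ i, P i (z i) := by
      intro z
      have hz0 : 0 ≤ ∏ i, P i (z i) := Finset.prod_nonneg fun i _ => hP0 i _
      by_cases hex : ∃ ω₀, Z ω₀ = z ∧ 0 < w ω₀
      · obtain ⟨ω₀, hω₀, hpos⟩ := hex
        have hQpos : 0 < Q (V ω₀) := hpos.trans_le (le_weightedLaw hw V ω₀)
        calc ∑ ω with Z ω = z, w ω * ((∏ i, P i (Y i ω)) / Q (V ω))
            = ∑ ω with Z ω = z, w ω * ((∏ i, P i (z i)) / Q (V ω₀)) := by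
              refine Finset.sum_congr rfl fun ω hω => ?_
              have hωz : Z ω = z := (Finset.mem_filter.1 hω).2
              rcases (hw ω).eq_or_lt with h0 | h0
              · rw [← h0, zero_mul, zero_mul]
              · rw [hV ω ω₀ h0 hpos fun i => congrFun (hωz.trans hω₀.symm) i, ← hωz]
          _ = (∑ ω with Z ω = z, w ω) * ((∏ i, P i (z i)) / Q (V ω₀)) := by
              rw [Finset.sum_mul]
          _ ≤ Q (V ω₀) * ((∏ i, P i (z i)) / Q (V ω₀)) := by
              refine mul_le_mul_of_nonneg_right ?_ (div_nonneg hz0 hQpos.le)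
              rw [hQ, weightedLaw, Finset.sum_filter, Finset.sum_filter]
              refine Finset.sum_le_sum fun ω _ => ?_
              split_ifs with h1 h2
              · exact le_rfl
              · rcases (hw ω).eq_or_lt with h0 | h0
                · exact h0.symm.le
                · exact absurd (hV ω ω₀ h0 hpos fun i => congrFun (h1.trans hω₀.symm) i) h2
              · exact hw ω
              · exact le_rfl
          _ = ∏ i, P i (z i) := mul_div_cancel₀ _ hQpos.ne'
      · push Not at hex
        refine le_trans (le_of_eq (Finset.sum_eq_zero fun ω hω => ?_)) hz0
        rw [le_antisymm (hex ω (Finset.mem_filter.1 hω).2) (hw ω), zero_mul]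
    calc ∑ ω, w ω * ((∏ i, P i (Y i ω)) / Q (V ω))
        = ∑ z ∈ Finset.univ.image Z, ∑ ω with Z ω = z,
            w ω * ((∏ i, P i (Y i ω)) / Q (V ω)) :=
          (Finset.sum_fiberwise_of_maps_to
            (fun ω _ => Finset.mem_image_of_mem _ (Finset.mem_univ ω)) _).symm
      _ ≤ ∑ z ∈ Finset.univ.image Z, ∏ i, P i (z i) := Finset.sum_le_sum fun z _ => hfib z
      _ ≤ ∑ z ∈ Fintype.piFinset fun i => Finset.univ.image (Y i), ∏ i, P i (z i) := by
          refine Finset.sum_le_sum_of_subset_of_nonneg ?_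
            fun z _ _ => Finset.prod_nonneg fun i _ => hP0 i _
          intro z hz
          obtain ⟨ω, -, rfl⟩ := Finset.mem_image.1 hz
          exact Fintype.mem_piFinset.2 fun i => Finset.mem_image_of_mem _ (Finset.mem_univ ω)
      _ = ∏ i, ∑ x ∈ Finset.univ.image (Y i), P i x := (Finset.prod_univ_sum _ _).symm
      _ = 1 := Finset.prod_eq_one fun i _ => by rw [hP, sum_image_weightedLaw, hw1]
  -- This is `log u ≤ u - 1` at the likelihood ratio, weighted by `w ω`.
  have hlog : ∀ ω, w ω * -Real.log (Q (V ω)) - ∑ i, w ω * -Real.log (P i (Y i ω)) ≤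
      w ω * ((∏ i, P i (Y i ω)) / Q (V ω)) - w ω := by
    intro ω
    rcases (hw ω).eq_or_lt with h0 | h0
    · simp [← h0]
    have hQpos : 0 < Q (V ω) := h0.trans_le (le_weightedLaw hw V ω)
    have hPpos : ∀ i, 0 < P i (Y i ω) := fun i => h0.trans_le (le_weightedLaw hw (Y i) ω)
    have hprod : 0 < ∏ i, P i (Y i ω) := Finset.prod_pos fun i _ => hPpos i
    have h := Real.log_le_sub_one_of_pos (div_pos hprod hQpos)
    rw [Real.log_div hprod.ne' hQpos.ne', Real.log_prod (fun i _ => (hPpos i).ne')] at h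
    have h' := mul_le_mul_of_nonneg_left h h0.le
    rw [← Finset.mul_sum, Finset.sum_neg_distrib]
    linarith
  have hsum := Finset.sum_le_sum fun ω (_ : ω ∈ Finset.univ) => hlog ω
  rw [Finset.sum_sub_distrib, Finset.sum_sub_distrib, hw1, Finset.sum_comm] at hsum
  linarith

end FiniteEntropy

/-! ### Finitely many source symbols -/

section Source

/-- The probability of a finite source sequence. -/
noncomputable def prefixWeight {S : Type*} [MeasurableSpace S] (p : Measure S) {N : ℕ}
    (ω : Fin N → S) : ℝ := ∏ i, p.real {ω i}

theorem prefixWeight_nonneg {S : Type*} [MeasurableSpace S] (p : Measure S) {N : ℕ}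
    (ω : Fin N → S) : 0 ≤ prefixWeight p ω :=
  Finset.prod_nonneg fun _ _ => measureReal_nonneg

theorem measurable_prefix {S : Type*} [MeasurableSpace S] (N : ℕ) :
    Measurable fun (s : ℕ → S) (i : Fin N) => s i :=
  measurable_pi_lambda _ fun _ => measurable_pi_apply _

instance {S : Type*} [MeasurableSpace S] (p : Measure S) [IsProbabilityMeasure p] :
    IsProbabilityMeasure (sourceLaw p) := by
  unfold sourceLaw; infer_instance

theorem sourceLaw_real_prefix {S : Type*} [MeasurableSpace S] [DiscreteMeasurableSpace S]
    (p : Measure S) [IsProbabilityMeasure p] {N : ℕ} (ω : Fin N → S) :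
    (sourceLaw p).real {s | (fun i : Fin N => s i) = ω} = prefixWeight p ω := by
  have e : {s : ℕ → S | (fun i : Fin N => s i) = ω} =
      Set.pi (Finset.range N) fun i => {x | ∀ h : i < N, x = ω ⟨i, h⟩} := by
    ext s
    simp only [Set.mem_ofPred_eq, funext_iff, Set.mem_pi, Finset.coe_range, Set.mem_Iio]
    exact ⟨fun h i _ hi => h ⟨i, hi⟩, fun h i => h i i.2 i.2⟩
  rw [e, measureReal_def, sourceLaw, Measure.infinitePi_pi _ (fun _ _ => .of_discrete),
    ENNReal.toReal_prod, Finset.prod_range, prefixWeight]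
  refine Finset.prod_congr rfl fun i _ => ?_
  rw [measureReal_def]
  congr 2
  ext x
  simp

variable {S : Type*} [Fintype S] [MeasurableSpace S] [DiscreteMeasurableSpace S]
  (p : Measure S) [IsProbabilityMeasure p]

theorem sourceLaw_real_comp_prefix {N : ℕ} {X : Type*} (g : (Fin N → S) → X) (x : X) :
    (sourceLaw p).real ((fun s : ℕ → S => g fun i : Fin N => s i) ⁻¹' {x}) =
      weightedLaw (prefixWeight p) g x := by
  classical
  have e : ((fun s : ℕ → S => g fun i : Fin N => s i) ⁻¹' {x}) =
      ⋃ ω ∈ Finset.univ.filter (fun ω => g ω = x), {s : ℕ → S | (fun i : Fin N => s i) = ω} := by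
    ext s
    simp
  rw [e, measureReal_biUnion_finset, weightedLaw]
  · refine Finset.sum_congr (by congr!) fun ω _ => sourceLaw_real_prefix p ω
  · intro ω _ ω' _ h
    exact Set.disjoint_left.2 fun s h1 h2 => h (h1.symm.trans h2)
  · exact fun ω _ => measurable_prefix N (MeasurableSet.singleton ω)

theorem shannonEntropy_comp_prefix {N : ℕ} {X : Type*} (g : (Fin N → S) → X) :
    shannonEntropy (sourceLaw p) (fun s : ℕ → S => g fun i : Fin N => s i) =
      ∑ ω, prefixWeight p ω * -Real.log (weightedLaw (prefixWeight p) g (g ω)) := by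
  rw [← tsum_negMulLog_weightedLaw, shannonEntropy]
  simp only [sourceLaw_real_comp_prefix]

theorem sum_prefixWeight (N : ℕ) : ∑ ω : Fin N → S, prefixWeight p ω = 1 := by
  classical
  have h := sourceLaw_real_comp_prefix p (N := N) (fun _ => ()) ()
  rw [weightedLaw] at h
  simpa using h.symm

theorem weightedLaw_apply {N : ℕ} (i : Fin N) (x : S) :
    weightedLaw (prefixWeight p) (fun ω : Fin N → S => ω i) x = p.real {x} := by
  rw [← sourceLaw_real_comp_prefix, measureReal_def, measureReal_def, sourceLaw,
    ← (measurePreserving_eval_infinitePi (fun _ : ℕ => p) (i : ℕ)).measure_preimage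
      (MeasurableSet.singleton x).nullMeasurableSet]

theorem sourceEntropy_eq_sum {N : ℕ} (i : Fin N) :
    sourceEntropy p = ∑ ω : Fin N → S, prefixWeight p ω * -Real.log (p.real {ω i}) := by
  have h := tsum_negMulLog_weightedLaw (prefixWeight p) (fun ω : Fin N → S => ω i)
  simp only [weightedLaw_apply] at h
  rw [← h, sourceEntropy, shannonEntropy]
  rfl

/-- The first `m` source symbols have entropy `m H(s)`. -/
theorem shannonEntropy_prefix (m : ℕ) :
    shannonEntropy (sourceLaw p) (fun (s : ℕ → S) (i : Fin m) => s i) = m * sourceEntropy p := by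
  have hid : ∀ ω : Fin m → S, weightedLaw (prefixWeight p) id ω = prefixWeight p ω := by
    intro ω
    classical
    rw [weightedLaw, Finset.sum_eq_single ω]
    · exact fun ω' h h' => absurd (by simpa using h) h'
    · simp
  rw [shannonEntropy_comp_prefix p (fun ω : Fin m → S => ω)]
  calc ∑ ω : Fin m → S, prefixWeight p ω * -Real.log (weightedLaw (prefixWeight p) id ω)
      = ∑ ω : Fin m → S, ∑ i, prefixWeight p ω * -Real.log (p.real {ω i}) := by
        refine Finset.sum_congr rfl fun ω _ => ?_
        rw [hid]
        rcases (prefixWeight_nonneg p ω).eq_or_lt with h | h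
        · simp [← h]
        · rw [← Finset.mul_sum, Finset.sum_neg_distrib]
          nth_rewrite 2 [prefixWeight]
          rw [Real.log_prod fun i _ => ?_]
          exact fun h0 => h.ne' (Finset.prod_eq_zero (Finset.mem_univ i) h0)
    _ = ∑ i : Fin m, sourceEntropy p := by
        rw [Finset.sum_comm]
        exact Finset.sum_congr rfl fun i _ => (sourceEntropy_eq_sum p i).symm
    _ = m * sourceEntropy p := by simp

/-- If on a set of probability one finitely many causal channel symbols determine the first `m`
source symbols, then their marginal entropies add up to at least `m H(s)`. -/
theorem mul_sourceEntropy_le {X ι : Type*} [Fintype ι] (f : Encoder S X) (m : ℕ) (τ : ι → ℕ)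
    {G : Set (ℕ → S)} (hG : ∀ᵐ s ∂sourceLaw p, s ∈ G)
    (hdet : ∀ s ∈ G, ∀ s' ∈ G, (∀ i, f.output s (τ i) = f.output s' (τ i)) →
      ∀ k < m, s k = s' k) :
    m * sourceEntropy p ≤
      ∑ i, shannonEntropy (sourceLaw p) (fun s => f.output s (τ i)) := by
  classical
  obtain ⟨N, hmN, hτN⟩ : ∃ N, m ≤ N ∧ ∀ i, τ i < N :=
    ⟨m + ∑ i, (τ i + 1), Nat.le_add_right _ _, fun i => by
      have : τ i + 1 ≤ ∑ i, (τ i + 1) := Finset.single_le_sum (f := fun i => τ i + 1)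
        (fun _ _ => Nat.zero_le _) (Finset.mem_univ i)
      omega⟩
  -- A prefix of positive weight is a cylinder of positive measure, hence meets the almost sure set
  -- `G`; this turns almost sure decoding into a statement on finite prefixes.
  have hext : ∀ ω : Fin N → S, 0 < prefixWeight p ω → ∃ s ∈ G, (fun i : Fin N => s i) = ω := by
    intro ω hω
    rw [← sourceLaw_real_prefix, measureReal_def] at hω
    have h0 : (sourceLaw p) {s | (fun i : Fin N => s i) = ω} ≠ 0 := fun h => by simp [h] at hω
    have hf : ∃ᵐ s ∂sourceLaw p, (fun i : Fin N => s i) = ω :=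
      frequently_ae_iff.2 h0
    obtain ⟨s, hs, hsG⟩ := (hf.and_eventually hG).exists
    exact ⟨s, hsG, hs⟩
  have key := entropy_le_sum_entropy (prefixWeight_nonneg p) (sum_prefixWeight p N)
    (fun (ω : Fin N → S) (k : Fin m) => ω (Fin.castLE hmN k))
    (fun i (ω : Fin N → S) => f (τ i) fun k => ω (Fin.castLE (hτN i) k)) ?_
  · simp only [← shannonEntropy_comp_prefix] at key
    rw [← shannonEntropy_prefix]
    exact key
  · intro ω ω' h h' hY
    obtain ⟨s, hs, rfl⟩ := hext ω h
    obtain ⟨s', hs', rfl⟩ := hext ω' h'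
    funext k
    exact hdet s hs s' hs' hY k k.2

end Source

end Streaming
namespace Streaming

/-! ### The converse -/

theorem Encoder.output_congr {S X : Type*} (f : Encoder S X) {s s' : ℕ → S} {t : ℕ}
    (h : ∀ i ≤ t, s i = s' i) : f.output s t = f.output s' t := by
  unfold Encoder.output
  congr 1
  funext i
  exact h i (by omega)

/-- Almost surely, the channel symbols outside of a burst determine the source symbols. -/
theorem Achieves.exists_determined {S X : Type*} [MeasurableSpace S] {p : Measure S}
    {f : Encoder S X} {B D : ℕ} (h : Achieves p f B D) :
    ∃ G : Set (ℕ → S), (∀ᵐ s ∂sourceLaw p, s ∈ G) ∧ ∀ s ∈ G, ∀ s' ∈ G, ∀ j t : ℕ,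
      (∀ i ≤ t + D, ¬ (j ≤ i ∧ i < j + B) → f.output s i = f.output s' i) → s t = s' t := by
  obtain ⟨γ, hγ⟩ := h
  refine ⟨{s | ∀ j t, γ t (fun i => burstChannel j B (f.output s) i) = s t},
    ae_all_iff.2 fun j => ae_all_iff.2 fun t => hγ j t, fun s hs s' hs' j t h => ?_⟩
  rw [← hs j t, ← hs' j t]
  congr 1
  funext i
  unfold burstChannel
  split_ifs with hi
  · rfl
  · rw [h i (by omega) hi]

/-- On the channel erasing the first `α B` of every `α B + (α T - 1)` symbols, the unerased symbols
determine all the others if the delay of the second receiver is smaller than `α T + B`. -/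
theorem output_eq_of_periodic {S X : Type*} {f : Encoder S X} {B T α T₂ : ℕ} (hT : 1 ≤ T)
    (hα : 1 < α) (hT₂ : T₂ < α * T + B) {s s' : ℕ → S}
    (h₁ : ∀ j t : ℕ, (∀ i ≤ t + T, ¬ (j ≤ i ∧ i < j + B) → f.output s i = f.output s' i) →
      s t = s' t)
    (h₂ : ∀ j t : ℕ, (∀ i ≤ t + T₂, ¬ (j ≤ i ∧ i < j + α * B) → f.output s i = f.output s' i) →
      s t = s' t)
    (n : ℕ)
    (hn : ∀ i < n, ∀ r < α * T - 1,
      f.output s (i * (α * B + (α * T - 1)) + α * B + r) =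
        f.output s' (i * (α * B + (α * T - 1)) + α * B + r)) :
    ∀ t < n * (α * B + (α * T - 1)), f.output s t = f.output s' t := by
  have hc : 2 * T ≤ α * T := Nat.mul_le_mul_right T hα
  have hb : (α - 1) * B + B = α * B := by
    obtain ⟨ℓ, rfl⟩ : ∃ ℓ, α = ℓ + 1 := ⟨α - 1, by omega⟩
    rw [Nat.add_sub_cancel]; ring
  induction n with
  | zero => simp
  | succ n ih =>
    have ih := ih fun i hi => hn i (by omega)
    have hnew := hn n (by omega)
    rw [Nat.succ_mul]
    generalize n * (α * B + (α * T - 1)) = N at ih hnew ⊢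
    have hlate : ∀ i < N + (α * B + (α * T - 1)), N + α * B ≤ i →
        f.output s i = f.output s' i := by
      intro i hi hi'
      have := hnew (i - (N + α * B)) (by omega)
      rwa [Nat.add_sub_cancel' hi'] at this
    have hfirst : ∀ u < N + (α - 1) * B, s u = s' u := by
      intro u hu
      -- Here `u + T₂ ≤ N + αB + αT - 2`, which is the last index of the period.
      refine h₂ N u fun i hi hi' => ?_
      rcases lt_or_ge i N with h | h
      · exact ih i h
      · exact hlate i (by omega) (by omega)
    have hsecond : ∀ u < N + α * B, s u = s' u := by
      intro u hu
      refine h₁ (N + (α - 1) * B) u fun i hi hi' => ?_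
      rcases lt_or_ge i (N + (α - 1) * B) with h | h
      · exact f.output_congr fun k hk => hfirst k (by omega)
      · exact hlate i (by omega) (by omega)
    intro t ht
    rcases lt_or_ge t (N + α * B) with h | h
    · exact f.output_congr fun k hk => hsecond k (by omega)
    · exact hlate t ht h

section Converse

variable {S X : Type*} [Fintype S] [MeasurableSpace S] [DiscreteMeasurableSpace S]
  {p : Measure S} [IsProbabilityMeasure p] {f : Encoder S X} {B T α T₂ : ℕ}

/-- The entropy of the source symbols recovered over the periodic erasure channel. -/
theorem periodic_entropy_bound (hT : 1 ≤ T) (hα : 1 < α)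
    (h₁ : Achieves p f B T) (h₂ : Achieves p f (α * B) T₂) (hT₂ : T₂ < α * T + B) (n : ℕ) :
    ((n * (α * B + (α * T - 1)) - T : ℕ) : ℝ) * sourceEntropy p ≤
      ∑ i ∈ Finset.range n, ∑ r ∈ Finset.range (α * T - 1),
        shannonEntropy (sourceLaw p)
          (fun s => f.output s (i * (α * B + (α * T - 1)) + α * B + r)) := by
  obtain ⟨G₁, hG₁, hd₁⟩ := h₁.exists_determined
  obtain ⟨G₂, hG₂, hd₂⟩ := h₂.exists_determined
  have key := mul_sourceEntropy_le p f (n * (α * B + (α * T - 1)) - T)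
    (fun x : Fin n × Fin (α * T - 1) => x.1 * (α * B + (α * T - 1)) + α * B + x.2)
    (G := G₁ ∩ G₂) (hG₁.and hG₂) ?_
  · rw [Fintype.sum_prod_type] at key
    simp only [Finset.sum_range]
    exact key
  · intro s hs s' hs' hx k hk
    have hall := output_eq_of_periodic hT hα hT₂ (hd₁ s hs.1 s' hs'.1) (hd₂ s hs.2 s' hs'.2) n
      fun i hi r hr => hx (⟨i, hi⟩, ⟨r, hr⟩)
    -- All channel symbols of the `n` periods are known, so the burst is placed after them; the
    -- decoding delay costs the last `T` source symbols.
    exact hd₁ s hs.1 s' hs'.1 (n * (α * B + (α * T - 1))) k fun i hi _ => hall i (by omega)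

/-- The marginal entropy of the channel symbols cannot stay below a level smaller than
`(α B + α T - 1) / (α T - 1) * H(s)`. -/
theorem not_eventually_entropy_lt (hT : 1 ≤ T) (hα : 1 < α)
    (h₁ : Achieves p f B T) (h₂ : Achieves p f (α * B) T₂) (hT₂ : T₂ < α * T + B)
    (hH : 0 ≤ sourceEntropy p) {L : ℝ}
    (hL : ((α * T - 1 : ℕ) : ℝ) * L < ((α * B + (α * T - 1) : ℕ) : ℝ) * sourceEntropy p) :
    ¬ ∀ᶠ t in atTop, shannonEntropy (sourceLaw p) (fun s => f.output s t) < L := by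
  intro hev
  obtain ⟨N, hN⟩ := eventually_atTop.1 hev
  set P := α * B + (α * T - 1) with hP
  set c : ℕ → ℝ := fun i => ∑ r ∈ Finset.range (α * T - 1),
    shannonEntropy (sourceLaw p) (fun s => f.output s (i * P + α * B + r)) with hc
  have hPpos : 1 ≤ P := by
    have : 2 * T ≤ α * T := Nat.mul_le_mul_right T hα
    omega
  have hcL : ∀ i, N ≤ i → c i ≤ ((α * T - 1 : ℕ) : ℝ) * L := by
    intro i hi
    calc c i ≤ ∑ r ∈ Finset.range (α * T - 1), L := by
          refine Finset.sum_le_sum fun r _ => (hN _ ?_).le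
          have : i * 1 ≤ i * P := Nat.mul_le_mul_left i hPpos
          omega
      _ = _ := by simp
  -- After `k` further periods the gain `P H(s) - (αT - 1) L` per period outweighs the first `N`
  -- periods and the loss of `T` source symbols.
  obtain ⟨k, hk⟩ := exists_nat_gt ((∑ i ∈ Finset.range N, c i + T * sourceEntropy p) /
    (P * sourceEntropy p - ((α * T - 1 : ℕ) : ℝ) * L))
  rw [div_lt_iff₀ (sub_pos.2 hL)] at hk
  have hb := periodic_entropy_bound hT hα h₁ h₂ hT₂ (N + k)
  rw [Finset.sum_range_add] at hb
  have hb2 : ∑ i ∈ Finset.range k, c (N + i) ≤ k * (((α * T - 1 : ℕ) : ℝ) * L) := by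
    calc _ ≤ ∑ i ∈ Finset.range k, ((α * T - 1 : ℕ) : ℝ) * L :=
          Finset.sum_le_sum fun i _ => hcL _ (by omega)
      _ = _ := by simp
  have hcast : ((N + k : ℕ) : ℝ) * P - T ≤ (((N + k) * P - T : ℕ) : ℝ) := by
    rw [sub_le_iff_le_add]
    exact_mod_cast le_tsub_add
  have hb3 := (mul_le_mul_of_nonneg_right hcast hH).trans hb
  have hNP : 0 ≤ (N : ℝ) * P * sourceEntropy p := by positivity
  push_cast at hb3
  simp only [hc] at hb2 hk
  linarith

theorem rate_lt_of_delay_lt (hB : 1 ≤ B) (hT : 1 ≤ T) (hα : 1 < α) (hH : 0 < sourceEntropy p)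
    (h₁ : Achieves p f B T) (h₂ : Achieves p f (α * B) T₂) (hT₂ : T₂ < α * T + B) :
    rate p f < (T : ℝ≥0∞) / ((T : ℝ≥0∞) + (B : ℝ≥0∞)) := by
  have hTpos : (0 : ℝ) < T := by exact_mod_cast hT
  have hBpos : (0 : ℝ) < B := by exact_mod_cast hB
  have hαT : 2 * T ≤ α * T := Nat.mul_le_mul_right T hα
  have hQ : ((α * T - 1 : ℕ) : ℝ) = α * T - 1 := by
    rw [Nat.cast_sub (by omega)]; push_cast; ring
  have hQpos : (0 : ℝ) < ((α * T - 1 : ℕ) : ℝ) := by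
    have : 0 < α * T - 1 := by omega
    exact_mod_cast this
  -- The gap between the two levels comes from `(αT - 1)(T + B) = T (αB + αT - 1) - B`. A level `L`
  -- strictly inside it makes the rate inequality strict after the upper limit.
  obtain ⟨L, hL₁, hL₂⟩ : ∃ L, (T + B) / T * sourceEntropy p < L ∧
      L < ((α * B + (α * T - 1) : ℕ) : ℝ) * sourceEntropy p / ((α * T - 1 : ℕ) : ℝ) := by
    refine exists_between ?_
    rw [mul_div_right_comm]
    refine mul_lt_mul_of_pos_right ?_ hH
    rw [div_lt_div_iff₀ hTpos hQpos]
    push_cast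
    rw [hQ]
    nlinarith
  rw [lt_div_iff₀ hQpos, mul_comm] at hL₂
  have hLpos : 0 < L := lt_trans (by positivity) hL₁
  have hle : ENNReal.ofReal L ≤ limsup (fun t : ℕ =>
      ENNReal.ofReal (shannonEntropy (sourceLaw p) (fun s => f.output s t))) atTop := by
    by_contra! hlt
    refine not_eventually_entropy_lt hT hα h₁ h₂ hT₂ hH.le hL₂ ?_
    filter_upwards [eventually_lt_of_limsup_lt hlt] with t ht
    exact (ENNReal.ofReal_lt_ofReal_iff hLpos).1 ht
  calc rate p f ≤ ENNReal.ofReal (sourceEntropy p) / ENNReal.ofReal L :=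
        ENNReal.div_le_div_left hle _
    _ = ENNReal.ofReal (sourceEntropy p / L) := (ENNReal.ofReal_div_of_pos hLpos).symm
    _ < ENNReal.ofReal (T / (T + B)) := by
        rw [ENNReal.ofReal_lt_ofReal_iff (by positivity), div_lt_div_iff₀ hLpos (by positivity)]
        rw [div_mul_eq_mul_div, div_lt_iff₀ hTpos] at hL₁
        linarith
    _ = (T : ℝ≥0∞) / ((T : ℝ≥0∞) + (B : ℝ≥0∞)) := by
        rw [ENNReal.ofReal_div_of_pos (by positivity), ENNReal.ofReal_add hTpos.le hBpos.le,
          ENNReal.ofReal_natCast, ENNReal.ofReal_natCast]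

end Converse

end Streaming
namespace Streaming

/-! ### The rate of the DE-SCo -/

section Uniform

theorem shannonEntropy_eq_log_card {Ω X : Type*} [MeasurableSpace Ω] [Fintype X]
    {μ : Measure Ω} {Y : Ω → X} (h : ∀ x, μ.real (Y ⁻¹' {x}) = (Fintype.card X : ℝ)⁻¹) :
    shannonEntropy μ Y = Real.log (Fintype.card X) := by
  rcases isEmpty_or_nonempty X with hX | hX
  · simp [shannonEntropy]
  · have hc : (Fintype.card X : ℝ) ≠ 0 := by simp
    simp only [shannonEntropy, h, tsum_fintype, Real.negMulLog, Real.log_inv, Finset.sum_const,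
      Finset.card_univ, nsmul_eq_mul]
    field_simp

/-- A surjective homomorphism maps equal weights to the uniform distribution. -/
theorem weightedLaw_const_of_surjective {Ω X : Type*} [Fintype Ω] [AddGroup Ω] [Fintype X]
    [AddGroup X] {w : Ω → ℝ} {c : ℝ} (hc : ∀ ω, w ω = c) (hw : ∑ ω, w ω = 1) {g : Ω → X}
    (hg : ∀ ω ω', g (ω - ω') = g ω - g ω') (hsurj : Function.Surjective g) (x : X) :
    weightedLaw w g x = (Fintype.card X : ℝ)⁻¹ := by
  classical
  have h0 : ∀ x, weightedLaw w g x = weightedLaw w g 0 := by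
    intro x
    obtain ⟨ω₁, rfl⟩ := hsurj x
    simp only [weightedLaw, Finset.sum_filter, hc]
    refine Fintype.sum_equiv (Equiv.subRight ω₁) _ _ fun ω => ?_
    simp only [Equiv.subRight_apply, hg, sub_eq_zero]
  have hsum : ∑ x, weightedLaw w g x = 1 := by
    rw [← hw, ← sum_image_weightedLaw w g, Finset.image_univ_of_surjective hsurj]
  rw [Finset.sum_congr rfl fun y _ => (h0 y).trans (h0 x).symm, Finset.sum_const,
    Finset.card_univ, nsmul_eq_mul] at hsum
  exact eq_inv_of_mul_eq_one_right hsum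

theorem deSCo_sub {F : Type*} [Field F] {B T : ℕ} (H : Matrix (Fin (T - B)) (Fin B) F)
    (α t : ℕ) (ω ω' : Fin (t + 1) → Fin T → F) :
    deSCo H α t (ω - ω') = deSCo H α t ω - deSCo H α t ω' := by
  have e : subSymbol (ω - ω') =
      fun m τ => subSymbol ω m (τ + 0) - subSymbol ω' m (τ + 0) := by
    funext m τ
    simp only [add_zero, subSymbol]
    split_ifs <;> simp
  ext k
  · rfl
  · simp only [deSCo, e, Prod.snd_sub, Pi.sub_apply]
    rw [parityOne_shift_sub, parityTwo_shift_sub, add_zero, add_zero]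
    ring

/-- Any `(a, c)` is hit by sending `a` at time `t` and `c` in the first `B` sub-symbols at time `t -
T`. The check pI of index `k` then reads only `c k`, and pII reads only times before `t - T`. -/
theorem deSCo_surjective {F : Type*} [Field F] {B T : ℕ}
    (H : Matrix (Fin (T - B)) (Fin B) F) (hB : 1 ≤ B) (hBT : B ≤ T)
    (α : ℕ) {t : ℕ} (ht : T ≤ t) : Function.Surjective (deSCo H α t) := by
  rintro ⟨a, c⟩
  set ω : Fin (t + 1) → Fin T → F := fun i m =>
    if (i : ℕ) = t then a m else if h : (i : ℕ) = t - T ∧ (m : ℕ) < B then c ⟨m, h.2⟩ else 0 with hω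
  have hz : ∀ (m : ℕ) (τ : ℤ), τ < t → (B ≤ m ∨ τ < t - T) → subSymbol ω m τ = 0 := by
    intro m τ hτ hm
    unfold subSymbol
    split_ifs with h
    · simp only [hω]
      rw [if_neg (by omega), dif_neg (by omega)]
    · rfl
  refine ⟨ω, Prod.ext ?_ (funext fun k => ?_)⟩
  · simp [deSCo, hω]
  · have hk := k.2
    have h2 : parityTwo H (α - 1) (subSymbol ω) k ((t : ℤ) - (T + B)) = 0 := by
      refine parityTwo_eq_zero H hBT ?_ fun r hr => ?_
      · have : (0 : ℤ) ≤ ((α - 1 : ℕ) : ℤ) * T := by positivity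
        exact hz _ _ (by omega) (Or.inr (by omega))
      · have h1 : (0 : ℤ) ≤ ((α - 1 : ℕ) : ℤ) * (k + 1) := by positivity
        have h2 : (0 : ℤ) ≤ ((α - 1 : ℕ) : ℤ) * r := by positivity
        exact hz _ _ (by omega) (Or.inr (by omega))
    have h1 : parityOne H (subSymbol ω) k t = c k := by
      simp only [parityOne, ldParity, mainDiagonal]
      rw [Finset.sum_eq_zero fun m _ => ?_, add_zero, sub_add_cancel]
      · have hT : ((t : ℤ) - T).toNat = t - T := by omega
        rw [subSymbol, dif_pos ⟨by omega, by omega, by omega⟩]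
        simp only [hω]
        rw [if_neg (by omega), dif_pos ⟨hT, hk⟩]
      · have hm := m.2
        rw [hz _ _ (by omega) (Or.inl (by omega)), zero_mul]
    simp only [deSCo, h1, h2, add_zero]

variable {F : Type*} [Field F] [Fintype F] [MeasurableSpace F] [DiscreteMeasurableSpace F]
  {B T : ℕ}

instance : IsProbabilityMeasure (uniformSource F T) := by
  unfold uniformSource; infer_instance

theorem uniformSource_real_singleton (x : Fin T → F) :
    (uniformSource F T).real {x} = (Fintype.card (Fin T → F) : ℝ)⁻¹ := by
  rw [measureReal_def, uniformSource,
    PMF.toMeasure_apply_singleton _ _ (MeasurableSet.singleton x), PMF.uniformOfFintype_apply,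
    ENNReal.toReal_inv, ENNReal.toReal_natCast]

theorem sourceEntropy_uniformSource :
    sourceEntropy (uniformSource F T) = T * Real.log (Fintype.card F) := by
  rw [sourceEntropy, shannonEntropy_eq_log_card (Y := id) fun x => uniformSource_real_singleton x]
  simp

theorem deSCo_output_entropy (H : Matrix (Fin (T - B)) (Fin B) F) (hB : 1 ≤ B) (hBT : B ≤ T)
    (α : ℕ) {t : ℕ} (ht : T ≤ t) :
    shannonEntropy (sourceLaw (uniformSource F T)) (fun s => (deSCo H α).output s t) =
      (T + B) * Real.log (Fintype.card F) := by
  rw [shannonEntropy_eq_log_card (Y := fun s => (deSCo H α).output s t)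
    fun x => (sourceLaw_real_comp_prefix _ (deSCo H α t) x).trans
    (weightedLaw_const_of_surjective
      (c := ((Fintype.card (Fin T → F) : ℝ)⁻¹) ^ (t + 1))
      (fun ω => by simp only [prefixWeight, uniformSource_real_singleton]; simp)
      (sum_prefixWeight _ _) (deSCo_sub H α t) (deSCo_surjective H hB hBT α ht) x)]
  simp only [Fintype.card_prod, Fintype.card_pi, Finset.prod_const, Finset.card_univ,
    Fintype.card_fin]
  rw [← pow_add]
  push_cast
  rw [Real.log_pow]
  push_cast
  rfl

theorem log_card_pos (F : Type*) [Field F] [Fintype F] : 0 < Real.log (Fintype.card F) :=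
  Real.log_pos (by exact_mod_cast Fintype.one_lt_card)

theorem rate_deSCo (H : Matrix (Fin (T - B)) (Fin B) F) (hB : 1 ≤ B) (hBT : B ≤ T) (α : ℕ) :
    rate (uniformSource F T) (deSCo H α) = (T : ℝ≥0∞) / ((T : ℝ≥0∞) + (B : ℝ≥0∞)) := by
  have hlog := log_card_pos F
  have hTpos : (0 : ℝ) < T := by exact_mod_cast (by omega : 0 < T)
  have hBpos : (0 : ℝ) < B := by exact_mod_cast hB
  have hlim : limsup (fun t : ℕ => ENNReal.ofReal (shannonEntropy (sourceLaw (uniformSource F T))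
      (fun s => (deSCo H α).output s t))) atTop =
      ENNReal.ofReal ((T + B) * Real.log (Fintype.card F)) := by
    refine (limsup_congr ?_).trans (limsup_const _)
    filter_upwards [eventually_ge_atTop T] with t ht
    rw [deSCo_output_entropy H hB hBT α ht]
  rw [rate, hlim, sourceEntropy_uniformSource, ← ENNReal.ofReal_div_of_pos (by positivity),
    mul_div_mul_right _ _ hlog.ne', ENNReal.ofReal_div_of_pos (by positivity),
    ENNReal.ofReal_add hTpos.le hBpos.le, ENNReal.ofReal_natCast, ENNReal.ofReal_natCast]

end Uniform

/-! ### Existence of burst-erasure block codes -/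

/-- The systematic Reed-Solomon code over a large prime field is a burst-erasure block code. -/
theorem exists_isBurstErasureBlockCode (B T : ℕ) :
    ∃ (F : Type) (_ : Field F) (_ : Fintype F) (H : Matrix (Fin (T - B)) (Fin B) F),
      IsBurstErasureBlockCode H := by
  obtain ⟨p, hTp, hp⟩ := Nat.exists_infinite_primes T
  have := Fact.mk hp
  have hinj : ∀ c < T, ∀ c' < T, (c : ZMod p) = c' → c = c' := fun c hc c' hc' h =>
    CharP.natCast_injOn_Iio (ZMod p) p (Set.mem_Iio.2 (by omega)) (Set.mem_Iio.2 (by omega)) h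
  set v : Fin (T - B) → ZMod p := fun i => ((i : ℕ) : ZMod p) with hv
  have hvinj : Set.InjOn v (Finset.univ : Finset (Fin (T - B))) := fun i _ j _ h =>
    Fin.ext (hinj i (by omega) j (by omega) h)
  -- With this `H` the codeword of `n` lists the values at `0, …, T - 1` of the polynomial of degree
  -- below `T - B` interpolating `n` at `0, …, T - B - 1`.
  set H : Matrix (Fin (T - B)) (Fin B) (ZMod p) := fun m k =>
    (Lagrange.basis Finset.univ v m).eval ((T - B + k : ℕ) : ZMod p) with hH
  have hword : ∀ (n : Fin (T - B) → ZMod p) (c : ℕ), c < T → bebcWord H n c =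
      (Lagrange.interpolate Finset.univ v n).eval (c : ZMod p) := by
    intro n c hc
    unfold bebcWord
    split_ifs with h1 h2
    · exact (Lagrange.eval_interpolate_at_node n hvinj (Finset.mem_univ ⟨c, h1⟩)).symm
    · rw [Lagrange.interpolate_apply, Polynomial.eval_finsetSum]
      simp only [Polynomial.eval_mul, Polynomial.eval_C, Matrix.vecMul, dotProduct, hH]
      rw [show T - B + (c - (T - B)) = c by omega]
    · omega
  refine ⟨ZMod p, inferInstance, inferInstance, H, fun a ha n n' h => ?_⟩
  have hpoly : Lagrange.interpolate Finset.univ v n = Lagrange.interpolate Finset.univ v n' := by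
    -- The positions outside the window give `T - B` evaluation points, distinct because `p ≥ T`.
    refine Polynomial.eq_of_degrees_lt_of_eval_index_eq (Finset.Ico B T)
      (v := fun d => (((a + d) % T : ℕ) : ZMod p)) ?_ ?_ ?_ ?_
    · intro d hd d' hd' hdd
      rw [Finset.coe_Ico, Set.mem_Ico] at hd hd'
      have hm : (a + d) ≡ (a + d') [MOD T] :=
        hinj _ (Nat.mod_lt _ (by omega)) _ (Nat.mod_lt _ (by omega)) hdd
      exact (Nat.ModEq.add_left_cancel' a hm).eq_of_lt_of_lt hd.2 hd'.2
    · simpa using Lagrange.degree_interpolate_lt n hvinj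
    · simpa using Lagrange.degree_interpolate_lt n' hvinj
    · intro d hd
      rw [Finset.mem_Ico] at hd
      have hlt : (a + d) % T < T := Nat.mod_lt _ (by omega)
      rw [← hword n _ hlt, ← hword n' _ hlt]
      exact h d hd.1 hd.2
  funext i
  rw [← Lagrange.eval_interpolate_at_node n hvinj (Finset.mem_univ i), hpoly,
    Lagrange.eval_interpolate_at_node n' hvinj (Finset.mem_univ i)]

end Streaming

theorem theorem1 (B T α : ℕ) (hB : 1 ≤ B) (hBT : B ≤ T) (hα : 1 < α) :
    -- the minimum delay at receiver 2 among codes of rate `T / (T + B)`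
    IsLeast {T₂ : ℕ | AchievableAtRate ((T : ℝ≥0∞) / ((T : ℝ≥0∞) + (B : ℝ≥0∞))) B T (α * B) T₂}
      (α * T + B) ∧
    -- converse: a smaller delay forces a strictly smaller rate
    (∀ (S : Type*) (X : Type*) [Fintype S] [MeasurableSpace S] [DiscreteMeasurableSpace S]
      (p : Measure S) [IsProbabilityMeasure p] (f : Encoder S X) (T₂ : ℕ),
      0 < sourceEntropy p → Achieves p f B T → Achieves p f (α * B) T₂ → T₂ < α * T + B →
        rate p f < (T : ℝ≥0∞) / ((T : ℝ≥0∞) + (B : ℝ≥0∞))) ∧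
    -- burst-erasure block codes with the required parameters exist over some finite field
    (∃ (F : Type) (_ : Field F) (_ : Fintype F) (H : Matrix (Fin (T - B)) (Fin B) F),
      IsBurstErasureBlockCode H) ∧
    -- every DE-SCo built from such a block code is optimal
    (∀ (F : Type*) [Field F] [Fintype F] [MeasurableSpace F] [DiscreteMeasurableSpace F]
      (H : Matrix (Fin (T - B)) (Fin B) F), IsBurstErasureBlockCode H →
        rate (uniformSource F T) (deSCo H α) = (T : ℝ≥0∞) / ((T : ℝ≥0∞) + (B : ℝ≥0∞)) ∧
        Achieves (uniformSource F T) (deSCo H α) B T ∧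
        Achieves (uniformSource F T) (deSCo H α) (α * B) (α * T + B)) := by 
  have hT : 1 ≤ T := hB.trans hBT
  refine ⟨⟨?_, fun T₂ h => ?_⟩, ?_, exists_isBurstErasureBlockCode B T, ?_⟩
  · obtain ⟨F, hF, hF', H, hH⟩ := exists_isBurstErasureBlockCode B T
    let _ : MeasurableSpace F := ⊤
    have : DiscreteMeasurableSpace F := ⟨fun _ => trivial⟩
    refine ⟨Fin T → F, _, inferInstance, inferInstance, inferInstance, uniformSource F T,
      inferInstance, deSCo H α, ?_, rate_deSCo H hB hBT α, deSCo_achieves_first _ hH hBT α,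
      deSCo_achieves_second _ hH hBT hα⟩
    rw [sourceEntropy_uniformSource]
    exact mul_pos (by exact_mod_cast hT) (log_card_pos F)
  · obtain ⟨S, X, _, _, _, p, _, f, hpos, hrate, h₁, h₂⟩ := h
    by_contra! hlt
    exact (rate_lt_of_delay_lt hB hT hα hpos h₁ h₂ hlt).ne hrate
  · intro S X _ _ _ p _ f T₂ hpos h₁ h₂ hlt
    exact rate_lt_of_delay_lt hB hT hα hpos h₁ h₂ hlt
  · intro F _ _ _ _ H hH
    exact ⟨rate_deSCo H hB hBT α, deSCo_achieves_first _ hH hBT α,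
      deSCo_achieves_second _ hH hBT hα⟩
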